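/- Let $\mathcal A$ be an abelian category with enough projectives and enough injectives (for instance, the category $\mathsf{Mod}(R)$ of right modules over a ring $R$), and let $F\colon\mathcal A\to\mathsf{Ab}$ be an additive functor. For an object $X$ choose exact sequences $0\to\Omega X\to P\to X\to 0$ and $0\to X\to I\to\Sigma X\to 0$ with $P$ projective and $I$ injective. The satellites of $F$ are the functors determined by the exact sequences $0\to S_1F(X)\to F(\Omega X)\to F(P)$ and $F(I)\to F(\Sigma X)\to S^1F(X)\to 0$; put $S_0F=S^0F=F$, $S_n=S_1S_{n-1}$ and $S^n=S^1S^{n-1}$ for $n\ge 1$. On the category of additive functors $\mathcal A\to\mathsf{Ab}$, $S^n$ is left adjoint to $S_n$. $F$ is finitely presented if it is isomorphic to the cokernel of a natural transformation $\mathrm{Hom}_{\mathcal A}(Y,-)\to\mathrm{Hom}_{\mathcal A}(X,-)$ for some $X,Y\in\mathcal A$. $F$ is half exact if $F(A)\to F(B)\to F(C)$ is exact for every short exact sequence $0\to A\to B\to C\to 0$. An additive functor $G$ is projectively stable if the projection $G\to\operatorname{Coker}(L_0G\to G)$ is an isomorphism, and injectively stable if the inclusion $\operatorname{Ker}(G\to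 R^0G)\to G$ is an isomorphism, where $L_0$ and $R^0$ denote zeroth left and right derived functors. A half exact functor $F$ has $G$-dimension zero if all its satellites $S_nF$ and $S^nF$, $n\ge 0$ (including $F$ itself), are both projectively and injectively stable. **Theorem.** If $F$ is half exact, finitely presented and of $G$-dimension zero, then $F$ is horizontally linked, that is, the counit $S^2S_2F\to F$ of the adjunction $S^2\dashv S_2$ is an isomorphism. -/

import Mathlib

open CategoryTheory CategoryTheory.Limits

universe v v' u u'

noncomputable section

namespace FunctorLinkage

variable {C : Type u} [Category.{v} C] [Abelian C]
variable {D : Type u'} [Category.{v'} D] [Abelian D]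

/-! ### Syzygy and cosyzygy sequences -/

section Sequences

/-- A syzygy sequence `0 ⟶ ΩX ⟶ P ⟶ X ⟶ 0` with `P` projective. -/
abbrev syzygySeq [EnoughProjectives C] (X : C) : ShortComplex C :=
  ShortComplex.mk (kernel.ι (Projective.π X)) (Projective.π X) (kernel.condition _)

/-- A cosyzygy sequence `0 ⟶ X ⟶ I ⟶ ΣX ⟶ 0` with `I` injective. -/
abbrev cosyzygySeq [EnoughInjectives C] (X : C) : ShortComplex C :=
  ShortComplex.mk (Injective.ι X) (cokernel.π (Injective.ι X)) (cokernel.condition _)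

lemma syzygySeq_shortExact [EnoughProjectives C] (X : C) : (syzygySeq X).ShortExact where
  exact := ShortComplex.exact_kernel _
  mono_f := by dsimp [syzygySeq]; infer_instance
  epi_g := by dsimp [syzygySeq]; infer_instance

lemma cosyzygySeq_shortExact [EnoughInjectives C] (X : C) : (cosyzygySeq X).ShortExact where
  exact := ShortComplex.exact_cokernel _
  mono_f := by dsimp [cosyzygySeq]; infer_instance
  epi_g := by dsimp [cosyzygySeq]; infer_instance

instance [EnoughProjectives C] (X : C) : Projective (syzygySeq X).X₂ :=
  inferInstanceAs (Projective (Projective.over X))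

instance [EnoughInjectives C] (X : C) : Injective (cosyzygySeq X).X₂ :=
  inferInstanceAs (Injective (Injective.under X))

lemma exists_lift [EnoughProjectives C] {X : C} {S : ShortComplex C} (hS : S.ShortExact)
    (f : X ⟶ S.X₃) : ∃ φ : syzygySeq X ⟶ S, φ.τ₃ = f := by
  have := hS.epi_g
  have := hS.mono_f
  let p : (syzygySeq X).X₂ ⟶ S.X₂ := Projective.factorThru ((syzygySeq X).g ≫ f) S.g
  have hp : p ≫ S.g = (syzygySeq X).g ≫ f := Projective.factorThru_comp _ _
  have h0 : ((syzygySeq X).f ≫ p) ≫ S.g = 0 := by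
    rw [Category.assoc, hp, ← Category.assoc, (syzygySeq X).zero, zero_comp]
  exact ⟨{ τ₁ := hS.exact.lift _ h0, τ₂ := p, τ₃ := f
           comm₁₂ := hS.exact.lift_f _ h0
           comm₂₃ := hp }, rfl⟩

lemma exists_extension [EnoughInjectives C] {Y : C} {S : ShortComplex C} (hS : S.ShortExact)
    (f : S.X₁ ⟶ Y) : ∃ φ : S ⟶ cosyzygySeq Y, φ.τ₁ = f := by
  have := hS.epi_g
  have := hS.mono_f
  let p : S.X₂ ⟶ (cosyzygySeq Y).X₂ := Injective.factorThru (f ≫ (cosyzygySeq Y).f) S.f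
  have hp : S.f ≫ p = f ≫ (cosyzygySeq Y).f := Injective.comp_factorThru _ _
  have h0 : S.f ≫ p ≫ (cosyzygySeq Y).g = 0 := by
    rw [← Category.assoc, hp, Category.assoc, (cosyzygySeq Y).zero, comp_zero]
  exact ⟨{ τ₁ := f, τ₂ := p, τ₃ := hS.exact.desc _ h0
           comm₁₂ := hp.symm
           comm₂₃ := (hS.exact.g_desc _ h0).symm }, rfl⟩

/-- A chosen morphism from the syzygy sequence of `X` to a short exact sequence
extending `f : X ⟶ S.X₃`. -/
def lift [EnoughProjectives C] {X : C} {S : ShortComplex C} (hS : S.ShortExact)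
    (f : X ⟶ S.X₃) : syzygySeq X ⟶ S := (exists_lift hS f).choose

lemma lift_τ₃ [EnoughProjectives C] {X : C} {S : ShortComplex C} (hS : S.ShortExact)
    (f : X ⟶ S.X₃) : (lift hS f).τ₃ = f := (exists_lift hS f).choose_spec

/-- A chosen morphism from a short exact sequence to the cosyzygy sequence of `Y`
extending `f : S.X₁ ⟶ Y`. -/
def extension [EnoughInjectives C] {Y : C} {S : ShortComplex C} (hS : S.ShortExact)
    (f : S.X₁ ⟶ Y) : S ⟶ cosyzygySeq Y := (exists_extension hS f).choose

lemma extension_τ₁ [EnoughInjectives C] {Y : C} {S : ShortComplex C} (hS : S.ShortExact)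
    (f : S.X₁ ⟶ Y) : (extension hS f).τ₁ = f := (exists_extension hS f).choose_spec

/-- Two morphisms from a syzygy sequence that agree on the right end agree on the kernel
defining the left satellite. -/
lemma kernel_ι_map_eq [EnoughProjectives C] (F : C ⥤ D) [F.Additive] {X : C}
    {S : ShortComplex C} (hS : S.ShortExact) (φ ψ : syzygySeq X ⟶ S) (h : φ.τ₃ = ψ.τ₃) :
    kernel.ι (F.map (syzygySeq X).f) ≫ F.map φ.τ₁ =
      kernel.ι (F.map (syzygySeq X).f) ≫ F.map ψ.τ₁ := by
  have := hS.mono_f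
  have h0 : (φ.τ₂ - ψ.τ₂) ≫ S.g = 0 := by
    rw [Preadditive.sub_comp, φ.comm₂₃, ψ.comm₂₃, h, sub_self]
  have h1 : φ.τ₁ - ψ.τ₁ = (syzygySeq X).f ≫ hS.exact.lift _ h0 := by
    rw [← cancel_mono S.f, Category.assoc, hS.exact.lift_f, Preadditive.sub_comp,
      Preadditive.comp_sub, φ.comm₁₂, ψ.comm₁₂]
  rw [← sub_eq_zero, ← Preadditive.comp_sub, ← F.map_sub, h1, F.map_comp, ← Category.assoc,
    kernel.condition, zero_comp]

/-- Two morphisms to a cosyzygy sequence that agree on the left end agree modulo the image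
divided out in the right satellite. -/
lemma map_cokernel_π_eq [EnoughInjectives C] (F : C ⥤ D) [F.Additive] {Y : C}
    {S : ShortComplex C} (hS : S.ShortExact) (φ ψ : S ⟶ cosyzygySeq Y) (h : φ.τ₁ = ψ.τ₁) :
    F.map φ.τ₃ ≫ cokernel.π (F.map (cosyzygySeq Y).g) =
      F.map ψ.τ₃ ≫ cokernel.π (F.map (cosyzygySeq Y).g) := by
  have := hS.epi_g
  have h0 : S.f ≫ (φ.τ₂ - ψ.τ₂) = 0 := by
    rw [Preadditive.comp_sub, ← φ.comm₁₂, ← ψ.comm₁₂, h, sub_self]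
  have h1 : φ.τ₃ - ψ.τ₃ = hS.exact.desc _ h0 ≫ (cosyzygySeq Y).g := by
    rw [← cancel_epi S.g, ← Category.assoc, hS.exact.g_desc, Preadditive.sub_comp,
      Preadditive.comp_sub, φ.comm₂₃, ψ.comm₂₃]
  rw [← sub_eq_zero, ← Preadditive.sub_comp, ← F.map_sub, h1, F.map_comp, Category.assoc,
    cokernel.condition, comp_zero]

end Sequences

/-! ### The satellite endofunctors -/

section LeftSatellite

variable [EnoughProjectives C]

/-- `S₁F`, determined by `0 ⟶ S₁F(X) ⟶ F(ΩX) ⟶ F(P)`. -/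
def leftSatelliteObj (F : C ⥤ D) [F.Additive] : C ⥤ D where
  obj X := kernel (F.map (syzygySeq X).f)
  map {X Y} f := kernel.map _ _ (F.map (lift (S := syzygySeq Y) (syzygySeq_shortExact Y) f).τ₁)
    (F.map (lift (S := syzygySeq Y) (syzygySeq_shortExact Y) f).τ₂)
    (by rw [← F.map_comp, ← F.map_comp, ShortComplex.Hom.comm₁₂])
  map_id X := by
    rw [← cancel_mono (kernel.ι _), kernel.map, kernel.lift_ι]
    refine (kernel_ι_map_eq F (syzygySeq_shortExact X) _ (𝟙 (syzygySeq X)) (lift_τ₃ _ _)).trans ?_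
    simp
  map_comp {X Y Z} f g := by
    have h := kernel_ι_map_eq F (syzygySeq_shortExact Z)
      (lift (S := syzygySeq Z) (syzygySeq_shortExact Z) (f ≫ g))
      (lift (S := syzygySeq Y) (syzygySeq_shortExact Y) f ≫
        lift (S := syzygySeq Z) (syzygySeq_shortExact Z) g)
      (by rw [ShortComplex.comp_τ₃, lift_τ₃, lift_τ₃, lift_τ₃])
    rw [← cancel_mono (kernel.ι _)]
    simpa [kernel.map] using h

/-- The inclusion `S₁F(X) ⟶ F(ΩX)`. -/
def leftι (F : C ⥤ D) [F.Additive] (X : C) :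
    (leftSatelliteObj F).obj X ⟶ F.obj (syzygySeq X).X₁ :=
  kernel.ι (F.map (syzygySeq X).f)

instance (F : C ⥤ D) [F.Additive] (X : C) : Mono (leftι F X) :=
  inferInstanceAs (Mono (kernel.ι (F.map (syzygySeq X).f)))

lemma leftι_condition (F : C ⥤ D) [F.Additive] (X : C) :
    leftι F X ≫ F.map (syzygySeq X).f = 0 := kernel.condition _

/-- The universal property of `S₁F(X)` as a kernel. -/
def leftLift (F : C ⥤ D) [F.Additive] (X : C) {A : D} (k : A ⟶ F.obj (syzygySeq X).X₁)
    (hk : k ≫ F.map (syzygySeq X).f = 0) : A ⟶ (leftSatelliteObj F).obj X :=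
  kernel.lift _ k hk

@[simp]
lemma leftLift_ι (F : C ⥤ D) [F.Additive] (X : C) {A : D} (k : A ⟶ F.obj (syzygySeq X).X₁)
    (hk : k ≫ F.map (syzygySeq X).f = 0) : leftLift F X k hk ≫ leftι F X = k :=
  kernel.lift_ι _ _ _

@[simp]
lemma leftLift_ι_assoc (F : C ⥤ D) [F.Additive] (X : C) {A B : D}
    (k : A ⟶ F.obj (syzygySeq X).X₁) (hk : k ≫ F.map (syzygySeq X).f = 0)
    (h : F.obj (syzygySeq X).X₁ ⟶ B) : leftLift F X k hk ≫ leftι F X ≫ h = k ≫ h := by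
  rw [← Category.assoc, leftLift_ι]

lemma leftι_map_eq (F : C ⥤ D) [F.Additive] {X : C}
    {S : ShortComplex C} (hS : S.ShortExact) (φ ψ : syzygySeq X ⟶ S) (h : φ.τ₃ = ψ.τ₃) :
    leftι F X ≫ F.map φ.τ₁ = leftι F X ≫ F.map ψ.τ₁ :=
  kernel_ι_map_eq F hS φ ψ h

lemma leftSatelliteObj_map_ι (F : C ⥤ D) [F.Additive] {X Y : C} (f : X ⟶ Y)
    (φ : syzygySeq X ⟶ syzygySeq Y) (h : φ.τ₃ = f) :
    (leftSatelliteObj F).map f ≫ leftι F Y = leftι F X ≫ F.map φ.τ₁ := by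
  refine (kernel.lift_ι _ _ _).trans ?_
  exact kernel_ι_map_eq F (syzygySeq_shortExact Y) _ _ ((lift_τ₃ _ _).trans h.symm)

instance (F : C ⥤ D) [F.Additive] : (leftSatelliteObj F).Additive where
  map_add {X Y f g} := by
    obtain ⟨φ, hφ⟩ := exists_lift (syzygySeq_shortExact Y) f
    obtain ⟨ψ, hψ⟩ := exists_lift (syzygySeq_shortExact Y) g
    rw [← cancel_mono (leftι F Y), Preadditive.add_comp, leftSatelliteObj_map_ι F f φ hφ,
      leftSatelliteObj_map_ι F g ψ hψ,
      leftSatelliteObj_map_ι F (f + g) (φ + ψ) (by rw [ShortComplex.add_τ₃, hφ, hψ]),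
      ShortComplex.add_τ₁, F.map_add, Preadditive.comp_add]

/-- The action of `S₁` on natural transformations. -/
def leftSatelliteMap {F G : C ⥤ D} [F.Additive] [G.Additive] (α : F ⟶ G) :
    leftSatelliteObj F ⟶ leftSatelliteObj G where
  app X := leftLift G X (leftι F X ≫ α.app (syzygySeq X).X₁) (by
    rw [Category.assoc, ← α.naturality, reassoc_of% (leftι_condition F X), zero_comp])
  naturality X Y f := by
    obtain ⟨φ, hφ⟩ := exists_lift (syzygySeq_shortExact Y) f
    rw [← cancel_mono (leftι G Y), Category.assoc _ _ (leftι G Y), leftLift_ι,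
      Category.assoc _ _ (leftι G Y), leftSatelliteObj_map_ι G f φ hφ, leftLift_ι_assoc,
      reassoc_of% (leftSatelliteObj_map_ι F f φ hφ), Category.assoc, α.naturality]

@[simp]
lemma leftSatelliteMap_app_ι {F G : C ⥤ D} [F.Additive] [G.Additive] (α : F ⟶ G) (X : C) :
    (leftSatelliteMap α).app X ≫ leftι G X = leftι F X ≫ α.app (syzygySeq X).X₁ :=
  leftLift_ι _ _ _ _

@[simp]
lemma leftSatelliteMap_app_ι_assoc {F G : C ⥤ D} [F.Additive] [G.Additive] (α : F ⟶ G) (X : C)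
    {B : D} (h : G.obj (syzygySeq X).X₁ ⟶ B) :
    (leftSatelliteMap α).app X ≫ leftι G X ≫ h = leftι F X ≫ α.app (syzygySeq X).X₁ ≫ h := by
  rw [← Category.assoc, leftSatelliteMap_app_ι, Category.assoc]

variable (C D) in
/-- The left satellite `S₁` as an endofunctor of the category of additive functors. -/
def leftSatellite : (C ⥤+ D) ⥤ (C ⥤+ D) where
  obj F := AdditiveFunctor.of (leftSatelliteObj F.obj)
  map α := ObjectProperty.homMk (leftSatelliteMap α.hom)
  map_id F := by
    apply ObjectProperty.hom_ext
    ext X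
    apply (cancel_mono (leftι F.obj X)).1
    exact (leftSatelliteMap_app_ι _ X).trans
      ((Category.comp_id _).trans (Category.id_comp _).symm)
  map_comp {F G H} α β := by
    apply ObjectProperty.hom_ext
    ext X
    apply (cancel_mono (leftι H.obj X)).1
    change (leftSatelliteMap (α.hom ≫ β.hom)).app X ≫ leftι H.obj X =
      ((leftSatelliteMap α.hom).app X ≫ (leftSatelliteMap β.hom).app X) ≫ leftι H.obj X
    simp

end LeftSatellite

section RightSatellite

variable [EnoughInjectives C]

/-- `S¹F`, determined by `F(I) ⟶ F(ΣX) ⟶ S¹F(X) ⟶ 0`. -/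
def rightSatelliteObj (F : C ⥤ D) [F.Additive] : C ⥤ D where
  obj X := cokernel (F.map (cosyzygySeq X).g)
  map {X Y} f := cokernel.map _ _
    (F.map (extension (S := cosyzygySeq X) (cosyzygySeq_shortExact X) f).τ₂)
    (F.map (extension (S := cosyzygySeq X) (cosyzygySeq_shortExact X) f).τ₃)
    (by rw [← F.map_comp, ← F.map_comp, ShortComplex.Hom.comm₂₃])
  map_id X := by
    rw [← cancel_epi (cokernel.π _), cokernel.map, cokernel.π_desc]
    refine (map_cokernel_π_eq F (cosyzygySeq_shortExact X) _ (𝟙 (cosyzygySeq X))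
      (extension_τ₁ _ _)).trans ?_
    simp
  map_comp {X Y Z} f g := by
    have h := map_cokernel_π_eq F (cosyzygySeq_shortExact X)
      (extension (S := cosyzygySeq X) (cosyzygySeq_shortExact X) (f ≫ g))
      (extension (S := cosyzygySeq X) (cosyzygySeq_shortExact X) f ≫
        extension (S := cosyzygySeq Y) (cosyzygySeq_shortExact Y) g)
      (by rw [ShortComplex.comp_τ₁, extension_τ₁, extension_τ₁, extension_τ₁])
    rw [← cancel_epi (cokernel.π _)]
    simpa [cokernel.map] using h

/-- The projection `F(ΣX) ⟶ S¹F(X)`. -/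
def rightπ (F : C ⥤ D) [F.Additive] (X : C) :
    F.obj (cosyzygySeq X).X₃ ⟶ (rightSatelliteObj F).obj X :=
  cokernel.π (F.map (cosyzygySeq X).g)

instance (F : C ⥤ D) [F.Additive] (X : C) : Epi (rightπ F X) :=
  inferInstanceAs (Epi (cokernel.π (F.map (cosyzygySeq X).g)))

lemma rightπ_condition (F : C ⥤ D) [F.Additive] (X : C) :
    F.map (cosyzygySeq X).g ≫ rightπ F X = 0 := cokernel.condition _

/-- The universal property of `S¹F(X)` as a cokernel. -/
def rightDesc (F : C ⥤ D) [F.Additive] (X : C) {A : D} (k : F.obj (cosyzygySeq X).X₃ ⟶ A)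
    (hk : F.map (cosyzygySeq X).g ≫ k = 0) : (rightSatelliteObj F).obj X ⟶ A :=
  cokernel.desc _ k hk

@[simp]
lemma rightπ_desc (F : C ⥤ D) [F.Additive] (X : C) {A : D} (k : F.obj (cosyzygySeq X).X₃ ⟶ A)
    (hk : F.map (cosyzygySeq X).g ≫ k = 0) : rightπ F X ≫ rightDesc F X k hk = k :=
  cokernel.π_desc _ _ _

@[simp]
lemma rightπ_desc_assoc (F : C ⥤ D) [F.Additive] (X : C) {A B : D}
    (k : F.obj (cosyzygySeq X).X₃ ⟶ A) (hk : F.map (cosyzygySeq X).g ≫ k = 0) (h : A ⟶ B) :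
    rightπ F X ≫ rightDesc F X k hk ≫ h = k ≫ h := by
  rw [← Category.assoc, rightπ_desc]

lemma map_rightπ_eq (F : C ⥤ D) [F.Additive] {Y : C}
    {S : ShortComplex C} (hS : S.ShortExact) (φ ψ : S ⟶ cosyzygySeq Y) (h : φ.τ₁ = ψ.τ₁) :
    F.map φ.τ₃ ≫ rightπ F Y = F.map ψ.τ₃ ≫ rightπ F Y :=
  map_cokernel_π_eq F hS φ ψ h

lemma rightπ_rightSatelliteObj_map (F : C ⥤ D) [F.Additive] {X Y : C} (f : X ⟶ Y)
    (φ : cosyzygySeq X ⟶ cosyzygySeq Y) (h : φ.τ₁ = f) :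
    rightπ F X ≫ (rightSatelliteObj F).map f = F.map φ.τ₃ ≫ rightπ F Y := by
  refine (cokernel.π_desc _ _ _).trans ?_
  exact map_cokernel_π_eq F (cosyzygySeq_shortExact X) _ _ ((extension_τ₁ _ _).trans h.symm)

instance (F : C ⥤ D) [F.Additive] : (rightSatelliteObj F).Additive where
  map_add {X Y f g} := by
    obtain ⟨φ, hφ⟩ := exists_extension (cosyzygySeq_shortExact X) f
    obtain ⟨ψ, hψ⟩ := exists_extension (cosyzygySeq_shortExact X) g
    rw [← cancel_epi (rightπ F X), Preadditive.comp_add, rightπ_rightSatelliteObj_map F f φ hφ,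
      rightπ_rightSatelliteObj_map F g ψ hψ,
      rightπ_rightSatelliteObj_map F (f + g) (φ + ψ) (by rw [ShortComplex.add_τ₁, hφ, hψ]),
      ShortComplex.add_τ₃, F.map_add, Preadditive.add_comp]

/-- The action of `S¹` on natural transformations. -/
def rightSatelliteMap {F G : C ⥤ D} [F.Additive] [G.Additive] (α : F ⟶ G) :
    rightSatelliteObj F ⟶ rightSatelliteObj G where
  app X := rightDesc F X (α.app (cosyzygySeq X).X₃ ≫ rightπ G X) (by
    rw [α.naturality_assoc, rightπ_condition, comp_zero])
  naturality X Y f := by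
    obtain ⟨φ, hφ⟩ := exists_extension (cosyzygySeq_shortExact X) f
    rw [← cancel_epi (rightπ F X), reassoc_of% (rightπ_rightSatelliteObj_map F f φ hφ),
      rightπ_desc, rightπ_desc_assoc, Category.assoc, rightπ_rightSatelliteObj_map G f φ hφ,
      α.naturality_assoc]

@[simp]
lemma rightπ_rightSatelliteMap_app {F G : C ⥤ D} [F.Additive] [G.Additive] (α : F ⟶ G) (X : C) :
    rightπ F X ≫ (rightSatelliteMap α).app X = α.app (cosyzygySeq X).X₃ ≫ rightπ G X :=
  rightπ_desc _ _ _ _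

@[simp]
lemma rightπ_rightSatelliteMap_app_assoc {F G : C ⥤ D} [F.Additive] [G.Additive] (α : F ⟶ G)
    (X : C) {B : D} (h : (rightSatelliteObj G).obj X ⟶ B) :
    rightπ F X ≫ (rightSatelliteMap α).app X ≫ h =
      α.app (cosyzygySeq X).X₃ ≫ rightπ G X ≫ h := by
  rw [← Category.assoc, rightπ_rightSatelliteMap_app, Category.assoc]

variable (C D) in
/-- The right satellite `S¹` as an endofunctor of the category of additive functors. -/
def rightSatellite : (C ⥤+ D) ⥤ (C ⥤+ D) where
  obj F := AdditiveFunctor.of (rightSatelliteObj F.obj)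
  map α := ObjectProperty.homMk (rightSatelliteMap α.hom)
  map_id F := by
    apply ObjectProperty.hom_ext
    ext X
    apply (cancel_epi (rightπ F.obj X)).1
    exact (rightπ_rightSatelliteMap_app _ X).trans
      ((Category.id_comp _).trans (Category.comp_id _).symm)
  map_comp {F G H} α β := by
    apply ObjectProperty.hom_ext
    ext X
    apply (cancel_epi (rightπ F.obj X)).1
    change rightπ F.obj X ≫ (rightSatelliteMap (α.hom ≫ β.hom)).app X =
      rightπ F.obj X ≫ (rightSatelliteMap α.hom).app X ≫ (rightSatelliteMap β.hom).app X
    simp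

end RightSatellite

/-! ### The adjunction between the satellites -/

section Adjunction

open scoped ZeroObject

/-- The connecting morphism `S₁G(S.X₃) ⟶ G(S.X₁)` of a short exact sequence. -/
def leftConnecting [EnoughProjectives C] (G : C ⥤ D) [G.Additive] {S : ShortComplex C}
    (hS : S.ShortExact) : (leftSatelliteObj G).obj S.X₃ ⟶ G.obj S.X₁ :=
  leftι G S.X₃ ≫ G.map (lift hS (𝟙 S.X₃)).τ₁

lemma leftConnecting_eq [EnoughProjectives C] (G : C ⥤ D) [G.Additive] {S : ShortComplex C}
    (hS : S.ShortExact) (φ : syzygySeq S.X₃ ⟶ S) (h : φ.τ₃ = 𝟙 S.X₃) :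
    leftConnecting G hS = leftι G S.X₃ ≫ G.map φ.τ₁ :=
  leftι_map_eq G hS _ _ ((lift_τ₃ _ _).trans h.symm)

lemma leftConnecting_naturality [EnoughProjectives C] (G : C ⥤ D) [G.Additive]
    {S T : ShortComplex C} (hS : S.ShortExact) (hT : T.ShortExact) (g : S ⟶ T) :
    (leftSatelliteObj G).map g.τ₃ ≫ leftConnecting G hT =
      leftConnecting G hS ≫ G.map g.τ₁ := by
  obtain ⟨φ, hφ⟩ := exists_lift (syzygySeq_shortExact T.X₃) g.τ₃
  rw [leftConnecting, reassoc_of% (leftSatelliteObj_map_ι G g.τ₃ φ hφ), leftConnecting,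
    Category.assoc, ← G.map_comp, ← G.map_comp, ← ShortComplex.comp_τ₁, ← ShortComplex.comp_τ₁]
  apply leftι_map_eq G hT
  rw [ShortComplex.comp_τ₃, ShortComplex.comp_τ₃, lift_τ₃, lift_τ₃, hφ]
  exact (Category.comp_id _).trans (Category.id_comp _).symm

/-- The connecting morphism `F(S.X₃) ⟶ S¹F(S.X₁)` of a short exact sequence. -/
def rightConnecting [EnoughInjectives C] (F : C ⥤ D) [F.Additive] {S : ShortComplex C}
    (hS : S.ShortExact) : F.obj S.X₃ ⟶ (rightSatelliteObj F).obj S.X₁ :=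
  F.map (extension hS (𝟙 S.X₁)).τ₃ ≫ rightπ F S.X₁

lemma rightConnecting_eq [EnoughInjectives C] (F : C ⥤ D) [F.Additive] {S : ShortComplex C}
    (hS : S.ShortExact) (φ : S ⟶ cosyzygySeq S.X₁) (h : φ.τ₁ = 𝟙 S.X₁) :
    rightConnecting F hS = F.map φ.τ₃ ≫ rightπ F S.X₁ :=
  map_rightπ_eq F hS _ _ ((extension_τ₁ _ _).trans h.symm)

lemma rightConnecting_naturality [EnoughInjectives C] (F : C ⥤ D) [F.Additive]
    {S T : ShortComplex C} (hS : S.ShortExact) (hT : T.ShortExact) (g : S ⟶ T) :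
    F.map g.τ₃ ≫ rightConnecting F hT =
      rightConnecting F hS ≫ (rightSatelliteObj F).map g.τ₁ := by
  obtain ⟨φ, hφ⟩ := exists_extension (cosyzygySeq_shortExact S.X₁) g.τ₁
  rw [rightConnecting, rightConnecting, Category.assoc,
    rightπ_rightSatelliteObj_map F g.τ₁ φ hφ, ← Category.assoc, ← Category.assoc,
    ← F.map_comp, ← F.map_comp, ← ShortComplex.comp_τ₃, ← ShortComplex.comp_τ₃]
  apply map_rightπ_eq F hS
  rw [ShortComplex.comp_τ₁, ShortComplex.comp_τ₁, extension_τ₁, extension_τ₁, hφ]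
  exact (Category.comp_id _).trans (Category.id_comp _).symm

lemma rightConnecting_cosyzygySeq [EnoughInjectives C] (F : C ⥤ D) [F.Additive] (X : C) :
    rightConnecting F (cosyzygySeq_shortExact X) = rightπ F X := by
  refine (rightConnecting_eq F (cosyzygySeq_shortExact X) (𝟙 (cosyzygySeq X)) rfl).trans ?_
  simp

lemma leftConnecting_syzygySeq [EnoughProjectives C] (F : C ⥤ D) [F.Additive] (X : C) :
    leftConnecting F (syzygySeq_shortExact X) = leftι F X := by
  refine (leftConnecting_eq F (syzygySeq_shortExact X) (𝟙 (syzygySeq X)) rfl).trans ?_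
  simp

/-- The composite `S₁G(S.X₂) ⟶ S₁G(S.X₃) ⟶ G(S.X₁)` vanishes. -/
lemma map_leftConnecting [EnoughProjectives C] (G : C ⥤ D) [G.Additive]
    {S : ShortComplex C} (hS : S.ShortExact) :
    (leftSatelliteObj G).map S.g ≫ leftConnecting G hS = 0 := by
  let T : ShortComplex C := ShortComplex.mk (0 : (0 : C) ⟶ S.X₂) (𝟙 S.X₂) (by simp)
  have hT : T.ShortExact :=
    { exact := (ShortComplex.exact_iff_mono _ rfl).2 (by dsimp [T]; infer_instance)
      mono_f := ⟨fun _ _ _ => (isZero_zero C).eq_of_tgt _ _⟩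
      epi_g := by dsimp [T]; infer_instance }
  let g : T ⟶ S := { τ₁ := 0, τ₂ := 𝟙 _, τ₃ := S.g, comm₁₂ := by simp [T], comm₂₃ := by simp [T] }
  have h := leftConnecting_naturality G hT hS g
  have h0 : g.τ₁ = 0 := rfl
  rw [h0, G.map_zero, comp_zero] at h
  exact h

/-- The composite `F(S.X₃) ⟶ S¹F(S.X₁) ⟶ S¹F(S.X₂)` vanishes. -/
lemma rightConnecting_map [EnoughInjectives C] (F : C ⥤ D) [F.Additive]
    {S : ShortComplex C} (hS : S.ShortExact) :
    rightConnecting F hS ≫ (rightSatelliteObj F).map S.f = 0 := by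
  let T : ShortComplex C := ShortComplex.mk (𝟙 S.X₂) (0 : S.X₂ ⟶ (0 : C)) (by simp)
  have hT : T.ShortExact :=
    { exact := (ShortComplex.exact_iff_epi _ rfl).2 (by dsimp [T]; infer_instance)
      mono_f := by dsimp [T]; infer_instance
      epi_g := ⟨fun _ _ _ => (isZero_zero C).eq_of_src _ _⟩ }
  let g : S ⟶ T := { τ₁ := S.f, τ₂ := 𝟙 _, τ₃ := 0, comm₁₂ := by simp [T], comm₂₃ := by simp [T] }
  have h := rightConnecting_naturality F hS hT g
  have h0 : g.τ₃ = 0 := rfl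
  rw [h0, F.map_zero, zero_comp] at h
  exact h.symm

variable [EnoughProjectives C] [EnoughInjectives C]

/-- The natural transformation `F ⟶ S₁G` corresponding to `S¹F ⟶ G`. -/
def toLeftSatellite {F G : C ⥤ D} [F.Additive] [G.Additive] (φ : rightSatelliteObj F ⟶ G) :
    F ⟶ leftSatelliteObj G where
  app X := leftLift G X
    (rightConnecting F (syzygySeq_shortExact X) ≫ φ.app (syzygySeq X).X₁) (by
      rw [Category.assoc, ← φ.naturality,
        reassoc_of% (rightConnecting_map F (syzygySeq_shortExact X)), zero_comp])
  naturality X Y f := by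
    obtain ⟨g, hg⟩ := exists_lift (syzygySeq_shortExact Y) f
    have h := rightConnecting_naturality F (syzygySeq_shortExact X) (syzygySeq_shortExact Y) g
    rw [hg] at h
    rw [← cancel_mono (leftι G Y), Category.assoc _ _ (leftι G Y), leftLift_ι,
      Category.assoc _ _ (leftι G Y), leftSatelliteObj_map_ι G f g hg, leftLift_ι_assoc, Category.assoc, ← φ.naturality]
    exact (Category.assoc _ _ _).symm.trans ((h =≫ φ.app _).trans (Category.assoc _ _ _))

/-- The natural transformation `S¹F ⟶ G` corresponding to `F ⟶ S₁G`. -/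
def fromRightSatellite {F G : C ⥤ D} [F.Additive] [G.Additive] (ψ : F ⟶ leftSatelliteObj G) :
    rightSatelliteObj F ⟶ G where
  app X := rightDesc F X
    (ψ.app (cosyzygySeq X).X₃ ≫ leftConnecting G (cosyzygySeq_shortExact X)) (by
      rw [ψ.naturality_assoc, map_leftConnecting, comp_zero])
  naturality X Y f := by
    obtain ⟨g, hg⟩ := exists_extension (cosyzygySeq_shortExact X) f
    have h := leftConnecting_naturality G (cosyzygySeq_shortExact X) (cosyzygySeq_shortExact Y) g
    rw [hg] at h
    rw [← cancel_epi (rightπ F X), reassoc_of% (rightπ_rightSatelliteObj_map F f g hg),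
      rightπ_desc, rightπ_desc_assoc, ψ.naturality_assoc, Category.assoc]
    exact ψ.app _ ≫= h

lemma toLeftSatellite_app_ι {F G : C ⥤ D} [F.Additive] [G.Additive]
    (φ : rightSatelliteObj F ⟶ G) (X : C) :
    (toLeftSatellite φ).app X ≫ leftι G X =
      rightConnecting F (syzygySeq_shortExact X) ≫ φ.app (syzygySeq X).X₁ :=
  leftLift_ι _ _ _ _

lemma rightπ_fromRightSatellite_app {F G : C ⥤ D} [F.Additive] [G.Additive]
    (ψ : F ⟶ leftSatelliteObj G) (X : C) :
    rightπ F X ≫ (fromRightSatellite ψ).app X =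
      ψ.app (cosyzygySeq X).X₃ ≫ leftConnecting G (cosyzygySeq_shortExact X) :=
  rightπ_desc _ _ _ _

lemma fromRightSatellite_toLeftSatellite {F G : C ⥤ D} [F.Additive] [G.Additive]
    (φ : rightSatelliteObj F ⟶ G) : fromRightSatellite (toLeftSatellite φ) = φ := by
  ext X
  obtain ⟨g, hg⟩ := exists_lift (cosyzygySeq_shortExact X) (𝟙 (cosyzygySeq X).X₃)
  have h := rightConnecting_naturality F (syzygySeq_shortExact (cosyzygySeq X).X₃)
    (cosyzygySeq_shortExact X) g
  rw [hg, F.map_id, rightConnecting_cosyzygySeq] at h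
  rw [← cancel_epi (rightπ F X), rightπ_fromRightSatellite_app,
    leftConnecting_eq G (cosyzygySeq_shortExact X) g hg,
    reassoc_of% (toLeftSatellite_app_ι φ (cosyzygySeq X).X₃), ← φ.naturality,
    ← Category.assoc]
  refine (h.symm =≫ φ.app X).trans ?_
  exact (Category.id_comp _) =≫ φ.app X

lemma toLeftSatellite_fromRightSatellite {F G : C ⥤ D} [F.Additive] [G.Additive]
    (ψ : F ⟶ leftSatelliteObj G) : toLeftSatellite (fromRightSatellite ψ) = ψ := by
  ext X
  obtain ⟨g, hg⟩ := exists_extension (syzygySeq_shortExact X) (𝟙 (syzygySeq X).X₁)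
  have h := leftConnecting_naturality G (syzygySeq_shortExact X)
    (cosyzygySeq_shortExact (syzygySeq X).X₁) g
  rw [hg, G.map_id, leftConnecting_syzygySeq] at h
  rw [← cancel_mono (leftι G X), toLeftSatellite_app_ι,
    rightConnecting_eq F (syzygySeq_shortExact X) g hg, Category.assoc,
    rightπ_fromRightSatellite_app, ψ.naturality_assoc]
  refine (ψ.app X ≫= h).trans ?_
  exact ψ.app X ≫= Category.comp_id _

lemma fromRightSatellite_comp {F' F G : C ⥤ D} [F'.Additive] [F.Additive] [G.Additive]
    (α : F' ⟶ F) (ψ : F ⟶ leftSatelliteObj G) :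
    fromRightSatellite (α ≫ ψ) = rightSatelliteMap α ≫ fromRightSatellite ψ := by
  ext X
  rw [← cancel_epi (rightπ F' X), NatTrans.comp_app, rightπ_rightSatelliteMap_app_assoc,
    rightπ_fromRightSatellite_app, rightπ_fromRightSatellite_app, NatTrans.comp_app,
    Category.assoc]

lemma toLeftSatellite_comp {F G G' : C ⥤ D} [F.Additive] [G.Additive] [G'.Additive]
    (φ : rightSatelliteObj F ⟶ G) (β : G ⟶ G') :
    toLeftSatellite (φ ≫ β) = toLeftSatellite φ ≫ leftSatelliteMap β := by
  ext X
  rw [← cancel_mono (leftι G' X), NatTrans.comp_app, Category.assoc, leftSatelliteMap_app_ι,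
    toLeftSatellite_app_ι, reassoc_of% (toLeftSatellite_app_ι φ X), NatTrans.comp_app]

variable (C D) in
/-- The satellites form an adjoint pair `S¹ ⊣ S₁`. -/
def satelliteAdjunction : rightSatellite C D ⊣ leftSatellite C D :=
  Adjunction.mkOfHomEquiv
    { homEquiv := fun _ _ =>
        { toFun := fun φ => ObjectProperty.homMk (toLeftSatellite φ.hom)
          invFun := fun ψ => ObjectProperty.homMk (fromRightSatellite ψ.hom)
          left_inv := fun φ =>
            ObjectProperty.hom_ext _ (fromRightSatellite_toLeftSatellite φ.hom)
          right_inv := fun ψ =>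
            ObjectProperty.hom_ext _ (toLeftSatellite_fromRightSatellite ψ.hom) }
      homEquiv_naturality_left_symm := fun α ψ =>
        ObjectProperty.hom_ext _ (fromRightSatellite_comp α.hom ψ.hom)
      homEquiv_naturality_right := fun φ β =>
        ObjectProperty.hom_ext _ (toLeftSatellite_comp φ.hom β.hom) }

end Adjunction

/-! ### Iterated satellites -/

variable (C D) in
/-- `Sₙ`, defined by `S₀ = 1` and `Sₙ = S₁Sₙ₋₁`. -/
def iteratedLeftSatellite [EnoughProjectives C] : ℕ → ((C ⥤+ D) ⥤ (C ⥤+ D))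
  | 0 => 𝟭 _
  | n + 1 => iteratedLeftSatellite n ⋙ leftSatellite C D

variable (C D) in
/-- `Sⁿ`, defined by `S⁰ = 1` and `Sⁿ = S¹Sⁿ⁻¹`. -/
def iteratedRightSatellite [EnoughInjectives C] : ℕ → ((C ⥤+ D) ⥤ (C ⥤+ D))
  | 0 => 𝟭 _
  | n + 1 => iteratedRightSatellite n ⋙ rightSatellite C D

variable (C D) in
/-- The adjunction `S² ⊣ S₂`. -/
def secondSatelliteAdjunction [EnoughProjectives C] [EnoughInjectives C] :
    iteratedRightSatellite C D 2 ⊣ iteratedLeftSatellite C D 2 :=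
  (satelliteAdjunction C D).comp (satelliteAdjunction C D)

/-- The counit `S²S₂F ⟶ F`. -/
def linkageCounit [EnoughProjectives C] [EnoughInjectives C] (F : C ⥤+ D) :
    (iteratedRightSatellite C D 2).obj ((iteratedLeftSatellite C D 2).obj F) ⟶ F :=
  (secondSatelliteAdjunction C D).counit.app F

/-- `F` is horizontally linked if the counit `S²S₂F ⟶ F` is an isomorphism. -/
def IsHorizontallyLinked [EnoughProjectives C] [EnoughInjectives C] (F : C ⥤+ D) : Prop :=
  IsIso (linkageCounit F)

/-! ### Stable functors, `G`-dimension zero, finite presentation -/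

/-- The projective stabilization of `F`: the cokernel of the canonical map `L₀F ⟶ F`. -/
def projectiveStabilization [EnoughProjectives C] (F : C ⥤ D) [F.Additive] : C ⥤ D :=
  cokernel F.fromLeftDerivedZero

/-- The injective stabilization of `F`: the kernel of the canonical map `F ⟶ R⁰F`. -/
def injectiveStabilization [EnoughInjectives C] (F : C ⥤ D) [F.Additive] : C ⥤ D :=
  kernel F.toRightDerivedZero

/-- The projection of `F` onto its projective stabilization. -/
def toProjectiveStabilization [EnoughProjectives C] (F : C ⥤ D) [F.Additive] :
    F ⟶ projectiveStabilization F :=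
  cokernel.π F.fromLeftDerivedZero

/-- The inclusion into `F` of its injective stabilization. -/
def fromInjectiveStabilization [EnoughInjectives C] (F : C ⥤ D) [F.Additive] :
    injectiveStabilization F ⟶ F :=
  kernel.ι F.toRightDerivedZero

/-- `F` is projectively stable if it is its own projective stabilization. -/
def IsProjectivelyStable [EnoughProjectives C] (F : C ⥤ D) [F.Additive] : Prop :=
  IsIso (toProjectiveStabilization F)

/-- `F` is injectively stable if it is its own injective stabilization. -/
def IsInjectivelyStable [EnoughInjectives C] (F : C ⥤ D) [F.Additive] : Prop :=
  IsIso (fromInjectiveStabilization F)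

/-- `F` is half exact if it sends short exact sequences `0 ⟶ X ⟶ Y ⟶ Z ⟶ 0` to sequences
`F(X) ⟶ F(Y) ⟶ F(Z)` exact in the middle. -/
def IsHalfExact (F : C ⥤ D) [F.Additive] : Prop :=
  ∀ S : ShortComplex C, S.ShortExact → (S.map F).Exact

/-- All satellites `Sⁿ F`, `n ∈ ℤ` (where `S⁻ⁿ = Sₙ`, and `S⁰F = F`), are projectively and
injectively stable. -/
structure HasGDimensionZero [EnoughProjectives C] [EnoughInjectives C] (F : C ⥤+ D) : Prop where
  left_projectivelyStable (n : ℕ) :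
    IsProjectivelyStable ((iteratedLeftSatellite C D n).obj F).obj
  left_injectivelyStable (n : ℕ) :
    IsInjectivelyStable ((iteratedLeftSatellite C D n).obj F).obj
  right_projectivelyStable (n : ℕ) :
    IsProjectivelyStable ((iteratedRightSatellite C D n).obj F).obj
  right_injectivelyStable (n : ℕ) :
    IsInjectivelyStable ((iteratedRightSatellite C D n).obj F).obj

/-- `F : C ⥤ Ab` is finitely presented if it is isomorphic to the cokernel of a natural
transformation `(Y, -) ⟶ (X, -)` between representable functors. -/
def IsFinitelyPresented (F : C ⥤ AddCommGrpCat.{v}) : Prop :=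
  ∃ (X Y : C) (α : preadditiveCoyoneda.obj (Opposite.op Y) ⟶
    preadditiveCoyoneda.obj (Opposite.op X)), Nonempty (F ≅ cokernel α)

end FunctorLinkage

end

namespace FunctorLinkage

section HalfExact

variable {C : Type u} [Category.{v} C] [Abelian C]
variable {D : Type u'} [Category.{v'} D] [Abelian D]

/-! The point is dimension shifting along `0 ⟶ X ⟶ I ⟶ ΣX ⟶ 0`. For half exact `G` the connecting
morphism `S₁G(ΣX) ⟶ G(X)` sits in an exact sequence `S₁G(I) ⟶ S₁G(ΣX) ⟶ G(X) ⟶ G(I)`, so it is an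
isomorphism as soon as `G` and `S₁G` vanish on injectives. It factors as the epimorphism `S₁G(ΣX) ⟶
S¹S₁G(X)` followed by the counit `S¹S₁G(X) ⟶ G(X)`; hence both factors are isomorphisms
(`isIso_satelliteAdjunction_counit_app`).

Injective stability of `F`, `S₁F` and `S₂F` supplies the vanishing, and `S₁` preserves half
exactness (`IsHalfExact.leftSatelliteObj`). The shift therefore applies to both `F` and `S₁F`, and
the counit `S²S₂F ⟶ F` is the composite of `S¹` of the counit at `S₁F` with the counit at `F`. -/

/-- An injectively stable functor vanishes on injective objects. -/
lemma IsInjectivelyStable.isZero_obj [EnoughInjectives C] {F : C ⥤ D} [F.Additive]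
    (h : IsInjectivelyStable F) (I : C) [Injective I] : IsZero (F.obj I) := by
  have : IsIso (kernel.ι F.toRightDerivedZero) := h
  have h0 : F.toRightDerivedZero = 0 := by
    rw [← cancel_epi (kernel.ι F.toRightDerivedZero), kernel.condition, comp_zero]
  -- On an injective object `F ⟶ R⁰F` is an isomorphism, yet stability has just forced it to be
  -- zero.
  rw [IsZero.iff_id_eq_zero, ← cancel_mono (F.toRightDerivedZero.app I), h0]
  simp

/-! ### The cone sequence of a morphism of short exact sequences -/

section Presentation

variable {S T : ShortComplex C} (φ : T ⟶ S)

/-- The sequence `T.X₁ ⟶ S.X₁ ⊞ T.X₂ ⟶ S.X₂` attached to a morphism `T ⟶ S` of short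
complexes. -/
noncomputable abbrev coneSeq : ShortComplex C :=
  ShortComplex.mk (biprod.lift φ.τ₁ (-T.f)) (biprod.desc S.f φ.τ₂) (by simp [φ.comm₁₂])

/-- With equal right ends, `T.X₁ ⟶ S.X₁` and `T.X₂ ⟶ S.X₂` form a bicartesian square, whose total
sequence is exact. Half exactness can then be used on it to compare any short exact sequence with a
syzygy sequence. -/
lemma coneSeq_shortExact (hS : S.ShortExact) (hT : T.ShortExact) [IsIso φ.τ₃] :
    (coneSeq φ).ShortExact := by
  have := hS.mono_f
  have := hS.epi_g
  have := hT.mono_f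
  have := hT.epi_g
  refine { exact := ?_, mono_f := ?_, epi_g := ?_ }
  · rw [ShortComplex.exact_iff_exact_up_to_refinements]
    intro A x hx
    have hx' : (x ≫ biprod.fst) ≫ S.f + (x ≫ biprod.snd) ≫ φ.τ₂ = 0 := by
      have hd : biprod.desc S.f φ.τ₂ = biprod.fst ≫ S.f + biprod.snd ≫ φ.τ₂ := by
        ext <;> simp
      rw [Category.assoc, Category.assoc, ← Preadditive.comp_add, ← hd]
      exact hx
    have h2 : (x ≫ biprod.snd) ≫ T.g = 0 := by
      rw [← cancel_mono φ.τ₃, Category.assoc, ← φ.comm₂₃, ← Category.assoc,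
        eq_neg_of_add_eq_zero_right hx', Preadditive.neg_comp, Category.assoc, S.zero,
        comp_zero, neg_zero, zero_comp]
    obtain ⟨l, hl⟩ : ∃ l, l ≫ T.f = x ≫ biprod.snd := ⟨_, hT.exact.lift_f _ h2⟩
    -- The sign compensates for `-T.f` in the second component of the cone map.
    refine ⟨A, 𝟙 A, inferInstance, -l, ?_⟩
    rw [Category.id_comp]
    apply biprod.hom_ext
    · rw [← cancel_mono S.f, eq_neg_of_add_eq_zero_left hx', ← hl]
      simp [φ.comm₁₂]
    · rw [← hl]
      simp
  · have h : (coneSeq φ).f ≫ (-biprod.snd) = T.f := by simp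
    have : Mono ((coneSeq φ).f ≫ (-biprod.snd)) := by rw [h]; infer_instance
    exact mono_of_mono _ (-biprod.snd)
  · rw [epi_iff_surjective_up_to_refinements]
    intro A y
    -- Match the image of `y` in `S.X₃` by an element of `T.X₂`; the remaining difference comes from
    -- `S.X₁`.
    obtain ⟨A', π, hπ, p, hp⟩ := surjective_up_to_refinements_of_epi T.g (y ≫ S.g ≫ inv φ.τ₃)
    have h0 : (π ≫ y - p ≫ φ.τ₂) ≫ S.g = 0 := by
      rw [Preadditive.sub_comp, Category.assoc p, φ.comm₂₃, ← Category.assoc p, ← hp]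
      simp
    refine ⟨A', π, hπ, biprod.lift (hS.exact.lift _ h0) p, ?_⟩
    have hl := hS.exact.lift_f _ h0
    simp [hl]

end Presentation

/-! ### Exactness around the connecting morphism, and half exactness of `S₁` -/

variable [EnoughProjectives C]

/-- For a half exact functor, `S₁G(S.X₃) ⟶ G(S.X₁) ⟶ G(S.X₂)` is exact. -/
lemma IsHalfExact.exact_leftConnecting {G : C ⥤ D} [G.Additive] (hG : IsHalfExact G)
    {S : ShortComplex C} (hS : S.ShortExact) {A : D} (a : A ⟶ G.obj S.X₁)
    (ha : a ≫ G.map S.f = 0) :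
    ∃ (A' : D) (π : A' ⟶ A) (_ : Epi π) (z : A' ⟶ (leftSatelliteObj G).obj S.X₃),
      π ≫ a = z ≫ leftConnecting G hS := by
  let φ := lift hS (𝟙 S.X₃)
  have hφ : φ.τ₃ = 𝟙 S.X₃ := lift_τ₃ _ _
  have : IsIso φ.τ₃ := by rw [hφ]; exact inferInstanceAs (IsIso (𝟙 S.X₃))
  have hT := coneSeq_shortExact φ hS (syzygySeq_shortExact S.X₃)
  -- Since `(a, 0)` dies in `G(S.X₂)`, it lifts to some `z` in `G(ΩX₃)`. Its first component gives
  -- `a = z ≫ G.map φ.τ₁`; its second says that `z` dies in `G(P)`, that is, lies in `S₁G(X₃)`.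
  obtain ⟨A', π, hπ, z, hz⟩ := (hG _ hT).exact_up_to_refinements (a ≫ G.map biprod.inl) (by
    change (a ≫ G.map biprod.inl) ≫ G.map (biprod.desc S.f φ.τ₂) = 0
    rw [Category.assoc, ← G.map_comp, biprod.inl_desc, ha])
  change A' ⟶ G.obj (syzygySeq S.X₃).X₁ at z
  change π ≫ a ≫ G.map biprod.inl = z ≫ G.map (biprod.lift φ.τ₁ (-(syzygySeq S.X₃).f)) at hz
  have h1 : π ≫ a = z ≫ G.map φ.τ₁ := by
    have h := hz =≫ G.map biprod.fst
    rw [Category.assoc, Category.assoc, Category.assoc, ← G.map_comp, ← G.map_comp,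
      biprod.inl_fst, biprod.lift_fst, G.map_id, Category.comp_id] at h
    exact h
  have h2 : z ≫ G.map (syzygySeq S.X₃).f = 0 := by
    have h := hz =≫ G.map biprod.snd
    rw [Category.assoc, Category.assoc, Category.assoc, ← G.map_comp, ← G.map_comp,
      biprod.inl_snd, biprod.lift_snd, G.map_zero, comp_zero, comp_zero, G.map_neg,
      Preadditive.comp_neg] at h
    exact neg_eq_zero.1 h.symm
  refine ⟨A', π, hπ, leftLift G S.X₃ z h2, ?_⟩
  rw [h1, leftConnecting, leftLift_ι_assoc]

lemma IsHalfExact.epi_leftConnecting {G : C ⥤ D} [G.Additive] (hG : IsHalfExact G)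
    {S : ShortComplex C} (hS : S.ShortExact) (h : IsZero (G.obj S.X₂)) :
    Epi (leftConnecting G hS) := by
  rw [epi_iff_surjective_up_to_refinements]
  intro A a
  exact hG.exact_leftConnecting hS a (h.eq_of_tgt _ _)

/-- An element of `S₁G(X₃)` killed by the connecting morphism dies in both summands of `G(X₁ ⊞ P)`.
The cone sequence has right end `S.X₂`, so exactness at its left end makes the element come from
`S₁G(X₂) = 0`. -/
lemma IsHalfExact.mono_leftConnecting {G : C ⥤ D} [G.Additive] (hG : IsHalfExact G)
    {S : ShortComplex C} (hS : S.ShortExact) (h : IsZero ((leftSatelliteObj G).obj S.X₂)) :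
    Mono (leftConnecting G hS) := by
  rw [Preadditive.mono_iff_cancel_zero]
  intro A z hz
  let φ := lift hS (𝟙 S.X₃)
  have hφ : φ.τ₃ = 𝟙 S.X₃ := lift_τ₃ _ _
  have : IsIso φ.τ₃ := by rw [hφ]; exact inferInstanceAs (IsIso (𝟙 S.X₃))
  have hT := coneSeq_shortExact φ hS (syzygySeq_shortExact S.X₃)
  have hf : (coneSeq φ).f = φ.τ₁ ≫ biprod.inl - (syzygySeq S.X₃).f ≫ biprod.inr := by
    apply biprod.hom_ext <;> simp
  obtain ⟨A', π, hπ, w, hw⟩ := hG.exact_leftConnecting hT (z ≫ leftι G S.X₃) (by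
    rw [hf, G.map_sub, G.map_comp, G.map_comp, Preadditive.comp_sub, Category.assoc,
      Category.assoc, reassoc_of% (leftι_condition G S.X₃), zero_comp, comp_zero, sub_zero]
    have hz' : z ≫ leftι G S.X₃ ≫ G.map φ.τ₁ = 0 := hz
    rw [reassoc_of% hz', zero_comp])
  rw [← cancel_epi π, ← cancel_mono (leftι G S.X₃), Category.assoc, hw, h.eq_of_tgt w 0]
  simp

/-- The left satellite of a half exact functor is half exact. -/
lemma IsHalfExact.leftSatelliteObj {G : C ⥤ D} [G.Additive] (hG : IsHalfExact G) :
    IsHalfExact (leftSatelliteObj G) := by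
  intro S hS
  have := hS.epi_g
  have := hS.mono_f
  let U := syzygySeq S.X₂
  have hU : U.ShortExact := syzygySeq_shortExact S.X₂
  have := hU.epi_g
  have := hU.mono_f
  -- One projective `P` covers both `X₂` and `X₃`. With `K` the kernel of `P ⟶ X₃`, the kernels fit
  -- into `0 ⟶ ΩX₂ ⟶ K ⟶ X₁ ⟶ 0`, which is `W` below.
  let V : ShortComplex C := ShortComplex.mk (kernel.ι (U.g ≫ S.g)) (U.g ≫ S.g)
    (kernel.condition _)
  have hV : V.ShortExact :=
    { exact := ShortComplex.exact_kernel _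
      mono_f := by dsimp [V]; infer_instance
      epi_g := by dsimp only [V]; exact epi_comp U.g S.g }
  let i : U.X₁ ⟶ V.X₁ := kernel.lift _ U.f (by rw [U.zero_assoc, zero_comp])
  have hi : i ≫ V.f = U.f := kernel.lift_ι _ _ _
  have hq0 : (V.f ≫ U.g) ≫ S.g = 0 := (Category.assoc _ _ _).trans V.zero
  let q : V.X₁ ⟶ S.X₁ := hS.exact.lift _ hq0
  have hq : q ≫ S.f = V.f ≫ U.g := hS.exact.lift_f _ hq0
  let W : ShortComplex C := ShortComplex.mk i q (by
    rw [← cancel_mono S.f, Category.assoc, hq, reassoc_of% hi, U.zero, zero_comp])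
  have := hV.mono_f
  have hW : W.ShortExact := by
    refine { exact := ?_, mono_f := ?_, epi_g := ?_ }
    · rw [ShortComplex.exact_iff_exact_up_to_refinements]
      intro A x hx
      have hx' : x ≫ q = 0 := hx
      have h0 : (x ≫ V.f) ≫ U.g = 0 := by
        rw [Category.assoc, ← hq, reassoc_of% hx', zero_comp]
      refine ⟨A, 𝟙 A, inferInstance, hU.exact.lift _ h0, ?_⟩
      rw [← cancel_mono V.f, Category.id_comp, Category.assoc]
      exact (hU.exact.lift_f _ h0).symm.trans (hU.exact.lift _ h0 ≫= hi.symm)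
    · have : Mono (i ≫ V.f) := by rw [hi]; infer_instance
      exact mono_of_mono i V.f
    · rw [epi_iff_surjective_up_to_refinements]
      intro A y
      obtain ⟨A', π, hπ, p, hp⟩ := surjective_up_to_refinements_of_epi U.g (y ≫ S.f)
      have h0 : p ≫ V.g = 0 := by
        change p ≫ U.g ≫ S.g = 0
        rw [← Category.assoc, ← hp, Category.assoc, Category.assoc, S.zero, comp_zero, comp_zero]
      refine ⟨A', π, hπ, hV.exact.lift _ h0, ?_⟩
      change _ = _ ≫ q
      rw [← cancel_mono S.f, Category.assoc, Category.assoc, hq, hp,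
        reassoc_of% (hV.exact.lift_f _ h0)]
  let g : U ⟶ V :=
    { τ₁ := i, τ₂ := 𝟙 _, τ₃ := S.g
      comm₁₂ := hi.trans (Category.comp_id _).symm
      comm₂₃ := Category.id_comp _ }
  let f : W ⟶ U :=
    { τ₁ := 𝟙 _, τ₂ := V.f, τ₃ := S.f
      comm₁₂ := (Category.id_comp _).trans hi.symm
      comm₂₃ := hq.symm }
  -- Naturality along `W ⟶ U ⟶ V` translates exactness of `S₁G(X₁) ⟶ S₁G(X₂) ⟶ S₁G(X₃)` at the
  -- middle term into exactness of `S₁G(X₁) ⟶ G(ΩX₂) ⟶ G(K)` for `W`.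
  have hg : (FunctorLinkage.leftSatelliteObj G).map S.g ≫ leftConnecting G (S := V) hV =
      leftι G S.X₂ ≫ G.map i := by
    rw [← leftConnecting_syzygySeq]
    exact leftConnecting_naturality G hU hV g
  have hf : (FunctorLinkage.leftSatelliteObj G).map S.f ≫ leftι G S.X₂ =
      leftConnecting G (S := W) hW := by
    rw [← leftConnecting_syzygySeq]
    refine (leftConnecting_naturality G hW hU f).trans ?_
    change _ ≫ G.map (𝟙 _) = _
    rw [G.map_id]
    exact Category.comp_id _
  rw [ShortComplex.exact_iff_exact_up_to_refinements]
  intro A z hz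
  change A ⟶ (FunctorLinkage.leftSatelliteObj G).obj S.X₂ at z
  change z ≫ (FunctorLinkage.leftSatelliteObj G).map S.g = 0 at hz
  obtain ⟨A', π, hπ, w, hw⟩ := hG.exact_leftConnecting hW (z ≫ leftι G S.X₂) (by
    change (z ≫ leftι G S.X₂) ≫ G.map i = 0
    rw [Category.assoc, ← hg, reassoc_of% hz, zero_comp])
  refine ⟨A', π, hπ, w, ?_⟩
  rw [← hf] at hw
  apply (cancel_mono (leftι G S.X₂)).1
  exact (Category.assoc _ _ _).trans (hw.trans (Category.assoc _ _ _).symm)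

/-! ### The counits of `S¹ ⊣ S₁` and `S² ⊣ S₂` -/

variable [EnoughInjectives C]

/-- The counit `S¹S₁G ⟶ G` is an isomorphism if `G` is half exact and both `G` and `S₁G` vanish
on injective objects. -/
lemma isIso_satelliteAdjunction_counit_app (G : C ⥤+ D) (hG : IsHalfExact G.obj)
    (h₀ : ∀ (I : C) [Injective I], IsZero (G.obj.obj I))
    (h₁ : ∀ (I : C) [Injective I], IsZero ((leftSatelliteObj G.obj).obj I)) :
    IsIso ((satelliteAdjunction C D).counit.app G) := by
  have key : (satelliteAdjunction C D).counit.app G =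
      ObjectProperty.homMk (fromRightSatellite (𝟙 (leftSatelliteObj G.obj))) := by
    rfl
  have hX (X : C) : IsIso ((fromRightSatellite (𝟙 (leftSatelliteObj G.obj))).app X) := by
    have h := rightπ_fromRightSatellite_app (𝟙 (leftSatelliteObj G.obj)) X
    rw [NatTrans.id_app, Category.id_comp] at h
    have := hG.epi_leftConnecting (cosyzygySeq_shortExact X) (h₀ _)
    have := hG.mono_leftConnecting (cosyzygySeq_shortExact X) (h₁ _)
    have : IsIso (leftConnecting G.obj (cosyzygySeq_shortExact X)) := isIso_of_mono_of_epi _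
    rw [← h] at this
    -- The projection, always an epimorphism, is also mono because its composite with the counit is;
    -- cancelling it leaves the counit an isomorphism.
    have : Mono (rightπ (leftSatelliteObj G.obj) X) :=
      mono_of_mono _ ((fromRightSatellite (𝟙 (leftSatelliteObj G.obj))).app X)
    have : IsIso (rightπ (leftSatelliteObj G.obj) X) := isIso_of_mono_of_epi _
    exact IsIso.of_isIso_comp_left (rightπ (leftSatelliteObj G.obj) X) _
  have : IsIso (fromRightSatellite (𝟙 (leftSatelliteObj G.obj))) := NatIso.isIso_of_isIso_app _
  -- Additive functors form a full subcategory, so invertibility can be tested on underlying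
  -- functors.
  rw [key, ← isIso_iff_of_reflects_iso _ (ObjectProperty.ι _)]
  exact this

/-- A half exact functor is horizontally linked if its left satellites of order at most two
vanish on injective objects. -/
lemma IsHalfExact.isHorizontallyLinked {F : C ⥤+ D} (hF : IsHalfExact F.obj)
    (h₀ : ∀ (I : C) [Injective I], IsZero (F.obj.obj I))
    (h₁ : ∀ (I : C) [Injective I], IsZero ((FunctorLinkage.leftSatelliteObj F.obj).obj I))
    (h₂ : ∀ (I : C) [Injective I], IsZero ((FunctorLinkage.leftSatelliteObj
      (FunctorLinkage.leftSatelliteObj F.obj)).obj I)) :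
    IsHorizontallyLinked F := by
  have i₁ := isIso_satelliteAdjunction_counit_app F hF h₀ h₁
  have i₂ := isIso_satelliteAdjunction_counit_app ((leftSatellite C D).obj F)
    hF.leftSatelliteObj h₁ h₂
  have h : linkageCounit F = (rightSatellite C D).map
      ((satelliteAdjunction C D).counit.app ((leftSatellite C D).obj F)) ≫
        (satelliteAdjunction C D).counit.app F :=
    Adjunction.comp_counit_app (satelliteAdjunction C D) (satelliteAdjunction C D) F
  rw [IsHorizontallyLinked, h]
  exact IsIso.comp_isIso' (Functor.map_isIso _ _) i₁

end HalfExact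

end FunctorLinkage

theorem mainTheorem7 {C : Type u} [Category.{v} C] [Abelian C]
    [EnoughProjectives C] [EnoughInjectives C]
    (F : C ⥤+ AddCommGrpCat.{v})
    (hfp : FunctorLinkage.IsFinitelyPresented F.obj)
    (hhalf : FunctorLinkage.IsHalfExact F.obj)
    (hG : FunctorLinkage.HasGDimensionZero F) :
    FunctorLinkage.IsHorizontallyLinked F :=
  hhalf.isHorizontallyLinked
    -- Orders 0 and 1 serve the counit at `F`, orders 1 and 2 the counit at `S₁F`.
    (fun I _ => (hG.left_injectivelyStable 0).isZero_obj I)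
    (fun I _ => (hG.left_injectivelyStable 1).isZero_obj I)
    (fun I _ => (hG.left_injectivelyStable 2).isZero_obj I)
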